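/- Let $g\in\mathbb R$, $r_t,\eta_d\in[0,1]$, $\delta\in\mathbb C$, and put $C=r_t\tanh^2 g$. Let $u\in\mathbb C$ with $|u|=1$ (the relative phase of the heralded one-photon state $(|0,1\rangle+u|1,0\rangle)/\sqrt2$; $u=\pm i$ for the two possible clicks of the heralding detectors). On the two-mode Fock space, with modes $a_1$ (Alice) and $b_1$ (Bob), consider the heralded lossy one-photon state $$\rho_{\mathrm{out}}=(1-C)^3\sum_{m,n=0}^{\infty}C^{m+n}\,|\chi_{m,n}\rangle\langle\chi_{m,n}|,\qquad |\chi_{m,n}\rangle=\tfrac1{\sqrt2}\Big(\sqrt{n+1}\,|m,n+1\rangle+u\sqrt{m+1}\,|m+1,n\rangle\Big),$$ with $0^0=1$. Let $\rho_A=\mathrm{Tr}_B\,\rho_{\mathrm{out}}$ and $\rho_B=\mathrm{Tr}_A\,\rho_{\mathrm{out}}$ be the reduced states, let $D(\delta)=e^{\delta a^\dagger-\delta^* a}$ be the displacement operator of one mode, and let $\mathcal M_0=D(\delta)\,(1-\eta_d)^{a^\dagger a}\,D^\dagger(\delta)$ be the no-click element of displaced on/off detection with efficiency $\eta_d$. Then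 the no-click marginal $P_{\mathrm{1ph}}(0|\delta)=\mathrm{Tr}(\rho_x\mathcal M_0)$ is the same for $x=A$ and $x=B$, and equals $$P_{\mathrm{1ph}}(0|\delta)=\frac{1-C}{2}\left[\frac{2(1-C(1-\eta_d))^2-\eta_d(1-C(1-\eta_d))+(1-C)\eta_d^2|\delta|^2}{(1-C(1-\eta_d))^3}\right]\exp\!\left(-\frac{\eta_d(1-C)|\delta|^2}{1-C(1-\eta_d)}\right).$$ -/

import Mathlib

open scoped Nat InnerProductSpace

noncomputable section

namespace Photonic

/-- The Fock space of one bosonic mode, `ℓ²(ℕ, ℂ)`. -/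
abbrev Fock : Type := lp (fun _ : ℕ => ℂ) 2

/-- The Fock space of two bosonic modes (Alice's mode and Bob's mode), `ℓ²(ℕ × ℕ, ℂ)`. -/
abbrev Fock2 : Type := lp (fun _ : ℕ × ℕ => ℂ) 2

/-- The number state `|n⟩`. -/
def ket (n : ℕ) : Fock := lp.single 2 n 1

/-- The two-mode number state `|m, n⟩ = |m⟩ ⊗ |n⟩`. -/
def ket2 (m n : ℕ) : Fock2 := lp.single 2 (m, n) 1

/-! ### Ladder operators and the displacement operator -/

/-- Finite superpositions of number states, the common invariant domain of `a` and `a†`. -/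
abbrev FiniteFock : Type := ℕ →₀ ℂ

/-- The inclusion of the finite superpositions in the Fock space. -/
def toFock : FiniteFock →ₗ[ℂ] Fock := Finsupp.linearCombination ℂ ket

/-- The creation operator, `a† |n⟩ = √(n+1) |n+1⟩`. -/
def creation : FiniteFock →ₗ[ℂ] FiniteFock :=
  Finsupp.linearCombination ℂ fun n => Finsupp.single (n + 1) ((√(n + 1 : ℝ) : ℝ) : ℂ)

/-- The annihilation operator, `a |n⟩ = √n |n-1⟩` (hence `a |0⟩ = 0`). -/
def annihilation : FiniteFock →ₗ[ℂ] FiniteFock :=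
  Finsupp.linearCombination ℂ fun n => Finsupp.single (n - 1) ((√(n : ℝ) : ℝ) : ℂ)

/-- The generator `δ a† - δ* a` of the displacement operator. -/
def generator (δ : ℂ) : FiniteFock →ₗ[ℂ] FiniteFock :=
  δ • creation - (starRingEnd ℂ δ) • annihilation

/-- The `k`-th term `(δ a† - δ* a)ᵏ |m⟩ / k!` of the exponential series applied to `|m⟩`. -/
def displacementTerm (δ : ℂ) (m k : ℕ) : Fock :=
  ((k ! : ℂ)⁻¹) • toFock ((generator δ ^ k) (Finsupp.single m 1))

/-- The displaced number state `exp(δ a† - δ* a) |m⟩`, a norm convergent series in Fock space. -/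
def displacedKet (δ : ℂ) (m : ℕ) : Fock := ∑' k, displacementTerm δ m k

theorem inner_ket (m n : ℕ) : ⟪ket m, ket n⟫_ℂ = if m = n then 1 else 0 := by
  unfold ket
  rw [lp.inner_single_left, lp.single_apply]
  by_cases h : m = n
  · subst h; simp
  · simp [h]

theorem norm_ket (n : ℕ) : ‖ket n‖ = 1 := by
  unfold ket
  rw [lp.norm_single (by norm_num)]
  simp

theorem toFock_single (n : ℕ) (c : ℂ) : toFock (Finsupp.single n c) = c • ket n := by
  simp [toFock]

theorem generator_single (δ : ℂ) (n : ℕ) :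
    generator δ (Finsupp.single n 1) =
      (δ * ((√(n + 1 : ℝ) : ℝ) : ℂ)) • Finsupp.single (n + 1) 1
        - (starRingEnd ℂ δ * ((√(n : ℝ) : ℝ) : ℂ)) • Finsupp.single (n - 1) 1 := by
  simp [generator, creation, annihilation]

theorem generator_skew_single (δ : ℂ) (m n : ℕ) :
    ⟪toFock (generator δ (Finsupp.single m 1)), toFock (Finsupp.single n 1)⟫_ℂ =
      -⟪toFock (Finsupp.single m 1), toFock (generator δ (Finsupp.single n 1))⟫_ℂ := by
  rw [generator_single, generator_single]
  simp only [map_sub, map_smul, toFock_single, one_smul, inner_sub_left, inner_sub_right,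
    inner_smul_left, inner_smul_right, inner_ket, map_mul, Complex.conj_ofReal,
    RingHomCompTriple.comp_apply, RingHom.id_apply]
  rcases lt_trichotomy (m + 1) n with h | h | h
  · have h1 : m + 1 ≠ n := by omega
    have h2 : m - 1 ≠ n := by omega
    have h3 : m ≠ n + 1 := by omega
    have h4 : m ≠ n - 1 := by omega
    simp [h1, h2, h3, h4]
  · subst h
    have h2 : m - 1 ≠ m + 1 := by omega
    have h3 : m ≠ m + 1 + 1 := by omega
    simp [h2, h3]
  · rcases Nat.eq_zero_or_pos m with h0 | h0
    · subst h0
      have h1 : n = 0 := by omega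
      subst h1
      simp
    · by_cases h5 : m = n + 1
      · subst h5
        have h2 : n + 1 ≠ n - 1 := by omega
        have h3 : n + 1 + 1 ≠ n := by omega
        simp [h2, h3]
      · have h1 : m + 1 ≠ n := by omega
        have h2 : m - 1 ≠ n := by omega
        by_cases h4 : m = n - 1
        · omega
        · simp [h1, h2, h5, h4]

theorem generator_skew (δ : ℂ) (x y : FiniteFock) :
    ⟪toFock (generator δ x), toFock y⟫_ℂ = -⟪toFock x, toFock (generator δ y)⟫_ℂ := by
  induction x using Finsupp.induction_linear with
  | zero => simp
  | add x₁ x₂ h₁ h₂ =>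
    simp only [map_add, inner_add_left, h₁, h₂]
    ring
  | single m c =>
    induction y using Finsupp.induction_linear with
    | zero => simp
    | add y₁ y₂ h₁ h₂ =>
      simp only [map_add, inner_add_right, h₁, h₂]
      ring
    | single n d =>
      have hm : (Finsupp.single m c : FiniteFock) = c • Finsupp.single m 1 := by simp
      have hn : (Finsupp.single n d : FiniteFock) = d • Finsupp.single n 1 := by simp
      rw [hm, hn]
      simp only [map_smul, inner_smul_left, inner_smul_right, generator_skew_single]
      ring

theorem generator_pow_skew (δ : ℂ) (k : ℕ) (x y : FiniteFock) :
    ⟪toFock ((generator δ ^ k) x), toFock y⟫_ℂ =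
      (-1) ^ k * ⟪toFock x, toFock ((generator δ ^ k) y)⟫_ℂ := by
  induction k generalizing x y with
  | zero => simp
  | succ k ih =>
    have h1 : (generator δ ^ (k + 1)) x = (generator δ ^ k) (generator δ x) := by
      rw [pow_succ]; rfl
    have h2 : (generator δ ^ (k + 1)) y = generator δ ((generator δ ^ k) y) := by
      rw [pow_succ']; rfl
    rw [h1, h2, ih, generator_skew, pow_succ]
    ring

theorem norm_generator_pow_le (δ : ℂ) (k m : ℕ) :
    ‖toFock ((generator δ ^ k) (Finsupp.single m 1))‖ ≤
      (2 * ‖δ‖) ^ k * √((m + 1).ascFactorial k : ℝ) := by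
  induction k generalizing m with
  | zero => simp [toFock_single, norm_ket]
  | succ k ih =>
    have h1 : (generator δ ^ (k + 1)) (Finsupp.single m 1) =
        (generator δ ^ k) (generator δ (Finsupp.single m 1)) := by
      rw [pow_succ]; rfl
    rw [h1, generator_single]
    simp only [map_sub, map_smul]
    set B : ℝ := (2 * ‖δ‖) ^ k * √((m + 1 + 1).ascFactorial k : ℝ) with hB
    have hB0 : 0 ≤ B := by positivity
    have hp := ih (m + 1)
    have hq : ‖toFock ((generator δ ^ k) (Finsupp.single (m - 1) 1))‖ ≤ B := by
      refine (ih (m - 1)).trans ?_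
      rw [hB]
      have h2 : (m - 1 + 1).ascFactorial k ≤ (m + 1 + 1).ascFactorial k :=
        Nat.ascFactorial_le k (by omega)
      gcongr
    calc _ ≤ ‖(δ * ((√(m + 1 : ℝ) : ℝ) : ℂ)) •
              toFock ((generator δ ^ k) (Finsupp.single (m + 1) 1))‖ +
            ‖(starRingEnd ℂ δ * ((√(m : ℝ) : ℝ) : ℂ)) •
              toFock ((generator δ ^ k) (Finsupp.single (m - 1) 1))‖ := norm_sub_le _ _
      _ ≤ (‖δ‖ * √(m + 1 : ℝ)) * B + (‖δ‖ * √(m + 1 : ℝ)) * B := by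
          rw [norm_smul, norm_smul, norm_mul, norm_mul, RCLike.norm_conj, Complex.norm_real,
            Complex.norm_real, Real.norm_of_nonneg (Real.sqrt_nonneg _),
            Real.norm_of_nonneg (Real.sqrt_nonneg _)]
          gcongr
          linarith
      _ = (2 * ‖δ‖) ^ (k + 1) * √((m + 1).ascFactorial (k + 1) : ℝ) := by
          have h2 : (m + 1).ascFactorial (k + 1) = (m + 1) * (m + 1 + 1).ascFactorial k := by
            rw [Nat.succ_ascFactorial, Nat.ascFactorial_succ]
          rw [h2, hB]
          push_cast
          rw [Real.sqrt_mul (by positivity)]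
          ring

theorem summable_norm_displacementTerm (δ : ℂ) (m : ℕ) :
    Summable fun k => ‖displacementTerm δ m k‖ := by
  set c : ℝ := 2 * ‖δ‖ + 1 with hc
  have hc0 : 0 < c := by positivity
  let f : ℕ → ℝ := fun k => (k ! : ℝ)⁻¹ * (c ^ k * √((m + 1).ascFactorial k : ℝ))
  have hpos : ∀ k, 0 < f k := by
    intro k
    have h1 : (0 : ℝ) < ((m + 1).ascFactorial k : ℝ) := by
      exact_mod_cast Nat.ascFactorial_pos m k
    have h2 : (0 : ℝ) < (k ! : ℝ) := by exact_mod_cast Nat.factorial_pos k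
    positivity
  have hf : Summable f := by
    refine summable_of_ratio_test_tendsto_lt_one (l := 0) zero_lt_one
      (Filter.Eventually.of_forall fun k => (hpos k).ne') ?_
    have hle : ∀ k : ℕ, ‖f (k + 1)‖ / ‖f k‖ ≤ c * √(m + 1 : ℝ) * (1 / √((k : ℝ) + 1)) := by
      intro k
      have hk : ‖f (k + 1)‖ = c * √(m + 1 + k : ℝ) / (k + 1) * f k := by
        rw [Real.norm_of_nonneg (hpos _).le]
        simp only [f]
        rw [Nat.ascFactorial_succ, Nat.factorial_succ]
        push_cast
        rw [Real.sqrt_mul (by positivity), mul_inv, pow_succ]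
        field_simp
      rw [hk, Real.norm_of_nonneg (hpos k).le, mul_div_assoc, div_self (hpos k).ne', mul_one]
      have h1 : √(m + 1 + k : ℝ) ≤ √(m + 1 : ℝ) * √((k : ℝ) + 1) := by
        rw [← Real.sqrt_mul (by positivity)]
        apply Real.sqrt_le_sqrt
        have : (0 : ℝ) ≤ (m : ℝ) * k := by positivity
        nlinarith
      have h2 : √((k : ℝ) + 1) * √((k : ℝ) + 1) = k + 1 := Real.mul_self_sqrt (by positivity)
      have h3 : 0 < √((k : ℝ) + 1) := Real.sqrt_pos.2 (by positivity)
      calc c * √(m + 1 + k : ℝ) / (k + 1)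
          ≤ c * (√(m + 1 : ℝ) * √((k : ℝ) + 1)) / (k + 1) := by gcongr
        _ = c * √(m + 1 : ℝ) * (1 / √((k : ℝ) + 1)) := by
          have h4 : (k : ℝ) + 1 ≠ 0 := by positivity
          field_simp
          rw [pow_two, h2]
    have hlim : Filter.Tendsto (fun k : ℕ => c * √(m + 1 : ℝ) * (1 / √((k : ℝ) + 1)))
        Filter.atTop (nhds 0) := by
      have h1 : Filter.Tendsto (fun k : ℕ => √((k : ℝ) + 1)) Filter.atTop Filter.atTop :=
        Real.tendsto_sqrt_atTop.comp
          (Filter.tendsto_atTop_add_const_right _ _ tendsto_natCast_atTop_atTop)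
      have h2 := (tendsto_inv_atTop_zero.comp h1).const_mul (c * √(m + 1 : ℝ))
      simpa [Function.comp_def] using h2
    exact squeeze_zero (fun k => by positivity) hle hlim
  refine Summable.of_nonneg_of_le (fun k => norm_nonneg _) (fun k => ?_) hf
  unfold displacementTerm
  rw [norm_smul, norm_inv, Complex.norm_natCast]
  simp only [f]
  have h := norm_generator_pow_le δ k m
  have h' : (2 * ‖δ‖) ^ k ≤ c ^ k := by
    gcongr
    linarith
  gcongr
  exact h.trans (by gcongr)

/-- The exponential series defining `D(δ) |m⟩` converges. -/
theorem hasSum_displacementTerm (δ : ℂ) (m : ℕ) :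
    HasSum (displacementTerm δ m) (displacedKet δ m) :=
  (summable_norm_displacementTerm δ m).of_norm.hasSum

theorem inner_displacementTerm (δ : ℂ) (m n k l : ℕ) :
    ⟪displacementTerm δ m k, displacementTerm δ n l⟫_ℂ =
      ((k ! : ℂ)⁻¹ * (l ! : ℂ)⁻¹ * (-1) ^ k) *
        ⟪toFock (Finsupp.single m 1), toFock ((generator δ ^ (k + l)) (Finsupp.single n 1))⟫_ℂ := by
  unfold displacementTerm
  rw [inner_smul_left, inner_smul_right, generator_pow_skew, pow_add]
  simp only [map_inv₀, map_natCast, Module.End.mul_apply]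
  ring

theorem tsum_antidiagonal {F : ℕ × ℕ → ℂ} (hF : Summable F) :
    ∑' p, F p = ∑' N, ∑ p ∈ Finset.HasAntidiagonal.antidiagonal N, F p := by
  have hG : HasSum (F ∘ Finset.HasAntidiagonal.sigmaAntidiagonalEquivProd) (∑' p, F p) :=
    Finset.HasAntidiagonal.sigmaAntidiagonalEquivProd.hasSum_iff.2 hF.hasSum
  refine (HasSum.tsum_eq (hG.sigma fun N => ?_)).symm
  have h := hasSum_fintype
    (fun c : {x // x ∈ Finset.HasAntidiagonal.antidiagonal N} => F c.1)
  rw [Finset.sum_coe_sort (Finset.HasAntidiagonal.antidiagonal N) F] at h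
  exact h

theorem orthonormal_displacedKet (δ : ℂ) : Orthonormal ℂ (displacedKet δ) := by
  rw [orthonormal_iff_ite]
  intro m n
  let F : ℕ × ℕ → ℂ := fun p => ⟪displacementTerm δ m p.1, displacementTerm δ n p.2⟫_ℂ
  have hF : Summable F := by
    refine Summable.of_norm_bounded (g := fun p : ℕ × ℕ =>
      ‖displacementTerm δ m p.1‖ * ‖displacementTerm δ n p.2‖) ?_
      (fun p => norm_inner_le_norm _ _)
    exact (summable_norm_displacementTerm δ m).mul_of_nonneg
      (summable_norm_displacementTerm δ n) (fun _ => norm_nonneg _) (fun _ => norm_nonneg _)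
  have h1 : ∀ k, HasSum (fun l => F (k, l)) ⟪displacementTerm δ m k, displacedKet δ n⟫_ℂ :=
    fun k => (hasSum_displacementTerm δ n).mapL (innerSL ℂ (displacementTerm δ m k))
  have h2 : HasSum (fun k => ⟪displacementTerm δ m k, displacedKet δ n⟫_ℂ)
      ⟪displacedKet δ m, displacedKet δ n⟫_ℂ := by
    have h := ((hasSum_displacementTerm δ m).mapL
      (innerSL ℂ (displacedKet δ n))).map (starRingEnd ℂ) Complex.continuous_conj
    simpa [Function.comp_def, inner_conj_symm] using h
  have h3 : ⟪displacedKet δ m, displacedKet δ n⟫_ℂ = ∑' p, F p :=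
    (hF.hasSum.prod_fiberwise h1).unique h2 |>.symm
  have h5 : ∀ N, N ≠ 0 → ∑ p ∈ Finset.HasAntidiagonal.antidiagonal N, F p = 0 := by
    intro N hN
    have h6 : ∀ p ∈ Finset.HasAntidiagonal.antidiagonal N, F p =
        (((-1 : ℤ) ^ p.1 * (N.choose p.1 : ℤ) : ℤ) : ℂ) * ((N ! : ℂ)⁻¹ *
          ⟪toFock (Finsupp.single m 1), toFock ((generator δ ^ N) (Finsupp.single n 1))⟫_ℂ) := by
      intro p hp
      have hp' : p.1 + p.2 = N := Finset.HasAntidiagonal.mem_antidiagonal.1 hp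
      simp only [F]
      have h7 : ((N.choose p.1 : ℕ) : ℂ) * (p.1 ! : ℂ) * (p.2 ! : ℂ) = (N ! : ℂ) := by
        rw [← hp']
        have h := Nat.add_choose_mul_factorial_mul_factorial p.2 p.1
        rw [add_comm p.2 p.1] at h
        rw [← h]
        push_cast
        ring
      have h8 : (p.1 ! : ℂ) ≠ 0 := by exact_mod_cast Nat.factorial_ne_zero _
      have h9 : (p.2 ! : ℂ) ≠ 0 := by exact_mod_cast Nat.factorial_ne_zero _
      have h10 : (p.1 ! : ℂ)⁻¹ * (p.2 ! : ℂ)⁻¹ = (N.choose p.1 : ℂ) * (N ! : ℂ)⁻¹ := by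
        have h11 : (N ! : ℂ) ≠ 0 := by exact_mod_cast Nat.factorial_ne_zero _
        field_simp
        rw [← h7]
        ring
      rw [inner_displacementTerm, hp', h10]
      push_cast
      ring
    rw [Finset.sum_congr rfl h6, ← Finset.sum_mul, ← Int.cast_sum,
      Finset.Nat.sum_antidiagonal_eq_sum_range_succ
        (fun i _ => (-1 : ℤ) ^ i * (N.choose i : ℤ)),
      Int.alternating_sum_range_choose_of_ne hN]
    simp
  rw [h3, tsum_antidiagonal hF, tsum_eq_single 0 h5]
  simp [F, displacementTerm, toFock_single, inner_ket]

theorem orthonormal_ket2_left (m : ℕ) : Orthonormal ℂ fun n => ket2 n m := by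
  rw [orthonormal_iff_ite]
  intro i j
  unfold ket2
  rw [lp.inner_single_left, lp.single_apply]
  by_cases h : i = j
  · subst h; simp
  · simp [h]

theorem orthonormal_ket2_right (m : ℕ) : Orthonormal ℂ fun n => ket2 m n := by
  rw [orthonormal_iff_ite]
  intro i j
  unfold ket2
  rw [lp.inner_single_left, lp.single_apply]
  by_cases h : i = j
  · subst h; simp
  · simp [h]

/-- The displacement operator `D(δ) = exp(δ a† - δ* a)`: the isometry of the Fock space with
`D(δ) |m⟩ = exp(δ a† - δ* a) |m⟩`. -/
def displacement (δ : ℂ) : Fock →ₗᵢ[ℂ] Fock :=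
  (orthonormal_displacedKet δ).orthogonalFamily.linearIsometry

theorem displacement_ket (δ : ℂ) (m : ℕ) : displacement δ (ket m) = displacedKet δ m := by
  unfold displacement ket
  rw [OrthogonalFamily.linearIsometry_apply_single]
  simp

/-! ### The on/off measurement -/

/-- The no-click operator `(1 - η)^(a† a)` of an on/off detector of efficiency `η ∈ [0, 1]`:
the diagonal operator `|n⟩ ↦ (1 - η)ⁿ |n⟩`. -/
def noClick (η : unitInterval) : Fock →L[ℂ] Fock :=
  lp.mapCLM 2 (fun n : ℕ => (((1 - (η : ℝ)) ^ n : ℝ) : ℂ) • ContinuousLinearMap.id ℂ ℂ)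
    zero_le_one (fun n => by
      have h0 : 0 ≤ 1 - (η : ℝ) := by linarith [η.2.2]
      have h1 : 1 - (η : ℝ) ≤ 1 := by linarith [η.2.1]
      rw [norm_smul, ContinuousLinearMap.norm_id, mul_one, Complex.norm_real,
        Real.norm_of_nonneg (pow_nonneg h0 n)]
      exact pow_le_one₀ h0 h1)

theorem noClick_apply (η : unitInterval) (ψ : Fock) (n : ℕ) :
    noClick η ψ n = (((1 - (η : ℝ)) ^ n : ℝ) : ℂ) * ψ n := rfl

/-- The effective no-click element `M₀ = D(δ) (1 - η)^(a† a) D(δ)†` of the local measurement. -/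
def displacedNoClick (η : unitInterval) (δ : ℂ) : Fock →L[ℂ] Fock :=
  (displacement δ).toContinuousLinearMap ∘L noClick η ∘L
    ContinuousLinearMap.adjoint (displacement δ).toContinuousLinearMap

/-! ### The heralded state -/

/-- The (unnormalised) state of the two signal modes given that `m` photons of Alice's idler and
`n` photons of Bob's idler were lost, and that the single photon which reached Charlie was heralded
in the superposition `(|0,1⟩ + u |1,0⟩) / √2`. -/
def signalKet (u : ℂ) (m n : ℕ) : Fock2 :=
  (((√2)⁻¹ : ℝ) : ℂ) •
    (((√(n + 1 : ℝ) : ℝ) : ℂ) • ket2 m (n + 1) + (u * ((√(m + 1 : ℝ) : ℝ) : ℂ)) • ket2 (m + 1) n)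

/-- The heralded one-photon state
`ρ_out = (1 - C)³ ∑_{m,n} C^(m+n) |χ_{m,n}⟩⟨χ_{m,n}|`, `C = r_t tanh² g`, of the modes `a₁, b₁`,
where `χ_{m,n}` is `signalKet u m n`.  Multiplied out, this is
`(1 - C)³ / 2` times
`∑ Cᵐ |m⟩⟨m| ⊗ ∑ n Cⁿ⁻¹ |n⟩⟨n| + ∑ m Cᵐ⁻¹ |m⟩⟨m| ⊗ ∑ Cⁿ |n⟩⟨n|` plus the off-diagonal terms
`∑ Cᵐ √(m+1) ∑ Cⁿ √(n+1) (u* |m⟩⟨m+1| ⊗ |n+1⟩⟨n| + u |m+1⟩⟨m| ⊗ |n⟩⟨n+1|)`. -/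
def rhoOut (g rt : ℝ) (u : ℂ) : Fock2 →L[ℂ] Fock2 :=
  (((1 - rt * Real.tanh g ^ 2) ^ 3 : ℝ) : ℂ) •
    ∑' p : ℕ × ℕ, (((rt * Real.tanh g ^ 2) ^ (p.1 + p.2) : ℝ) : ℂ) •
      InnerProductSpace.rankOne ℂ (signalKet u p.1 p.2) (signalKet u p.1 p.2)

/-! ### Partial traces and traces -/

/-- The isometry `ψ ↦ ψ ⊗ |m⟩`. -/
def tensorKetRight (m : ℕ) : Fock →ₗᵢ[ℂ] Fock2 :=
  (orthonormal_ket2_left m).orthogonalFamily.linearIsometry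

/-- The isometry `ψ ↦ |m⟩ ⊗ ψ`. -/
def tensorKetLeft (m : ℕ) : Fock →ₗᵢ[ℂ] Fock2 :=
  (orthonormal_ket2_right m).orthogonalFamily.linearIsometry

theorem tensorKetRight_ket (m n : ℕ) : tensorKetRight m (ket n) = ket2 n m := by
  unfold tensorKetRight ket
  rw [OrthogonalFamily.linearIsometry_apply_single]
  simp

theorem tensorKetLeft_ket (m n : ℕ) : tensorKetLeft m (ket n) = ket2 m n := by
  unfold tensorKetLeft ket
  rw [OrthogonalFamily.linearIsometry_apply_single]
  simp

/-- Alice's reduced operator `Tr_B ρ = ∑ₘ (1 ⊗ ⟨m|) ρ (1 ⊗ |m⟩)`. -/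
def reducedA (ρ : Fock2 →L[ℂ] Fock2) : Fock →L[ℂ] Fock :=
  ∑' m : ℕ, ContinuousLinearMap.adjoint (tensorKetRight m).toContinuousLinearMap ∘L ρ ∘L
    (tensorKetRight m).toContinuousLinearMap

/-- Bob's reduced operator `Tr_A ρ = ∑ₘ (⟨m| ⊗ 1) ρ (|m⟩ ⊗ 1)`. -/
def reducedB (ρ : Fock2 →L[ℂ] Fock2) : Fock →L[ℂ] Fock :=
  ∑' m : ℕ, ContinuousLinearMap.adjoint (tensorKetLeft m).toContinuousLinearMap ∘L ρ ∘L
    (tensorKetLeft m).toContinuousLinearMap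

/-- `Tr T = c`, as a convergent sum `∑ₙ ⟨n|T|n⟩ = c` over the photon-number basis. -/
def HasTrace (T : Fock →L[ℂ] Fock) (c : ℂ) : Prop :=
  HasSum (fun n : ℕ => ⟪ket n, T (ket n)⟫_ℂ) c

end Photonic

end

/-!
The reduced states are diagonal in the photon number, so the trace only involves the diagonal
entries of the no-click element, and these are read off from its action on coherent vectors.

*The reduced states.* Projecting one mode of `signalKet u m n` on a number state leaves at most one
of its two terms, so the interference terms disappear from the partial trace
(`rankOne_partialKet`). The double series over the lost photons and the traced-out photon number
converges absolutely in operator norm; exchanging the two sums (`hasSum_reduced`) gives, for either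
mode, the diagonal operator with entries
`(1 - C)/2 Cⁿ + (1 - C)²/2 n Cⁿ⁻¹` (`coord_of_hasSum_reducedSignal`).

*The no-click element.* The canonical commutation relation gives `[G, a†] = -δ*` and `[G, a] = -δ`
for the generator `G = δ a† - δ* a`, hence `D a† = (a† - δ*) D` and `D a = (a - δ) D` in matrix
elements (`displacedKet_succ`, `displacedKet_coord_succ`). These recurrences determine `D` up to
`c = ⟨0|D|0⟩` and give `D e_w = c exp(-δ* w) e_{w+δ}` for the coherent vectors
`e_w = ∑ wⁿ/√n! |n⟩` (`displacement_coherent`). Since `D` is an isometry, the constant cancels in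
`M₀ = D (1-η)^(a†a) D†`, and `M₀ e_w = exp(-η|δ|² + η δ* w) e_{(1-η)w + ηδ}`. Comparing the
coefficients of `wⁿ` in the `n`-th coordinate gives `⟨n|M₀|n⟩` (`displacedNoClick_diag`).

*The trace.* With `q = 1 - η` and `t = η²|δ|²`, summing a double series gives
`∑ xⁿ ⟨n|M₀|n⟩ = exp(-η|δ|²) exp(xt/(1-qx))/(1-qx)` for `|x| < 1` (`hasSum_diag_generating`). The
trace is the combination of this function and its derivative at `x = C` prescribed by the
photon-number distribution.
-/

noncomputable section

namespace Photonic

theorem hasSum_of_eq {ι : Type*} {E : Type*} [AddCommMonoid E] [TopologicalSpace E]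
    {f g : ι → E} {a b : E} (h : HasSum f a) (hf : ∀ i, g i = f i) (ha : b = a) : HasSum g b := by
  rw [ha, show g = f from funext hf]
  exact h

/-! ### Commutation relations -/

theorem creation_single (n : ℕ) :
    creation (Finsupp.single n 1) = Finsupp.single (n + 1) ((√(n + 1 : ℝ) : ℝ) : ℂ) := by
  simp [creation]

theorem annihilation_single (n : ℕ) :
    annihilation (Finsupp.single n 1) = Finsupp.single (n - 1) ((√(n : ℝ) : ℝ) : ℂ) := by
  simp [annihilation]

theorem creation_apply (x : FiniteFock) (j : ℕ) :
    creation x j = ((√(j : ℝ) : ℝ) : ℂ) * x (j - 1) := by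
  induction x using Finsupp.induction_linear with
  | zero => simp
  | add x y hx hy => simp [hx, hy, mul_add]
  | single n c =>
    rcases j with _ | j
    · simp [creation]
    · by_cases h : n = j
      · subst h; simp [creation, mul_comm]
      · simp [creation, h]

theorem annihilation_apply (x : FiniteFock) (j : ℕ) :
    annihilation x j = ((√(j + 1 : ℝ) : ℝ) : ℂ) * x (j + 1) := by
  induction x using Finsupp.induction_linear with
  | zero => simp
  | add x y hx hy => simp [hx, hy, mul_add]
  | single n c =>
    rcases n with _ | n
    · simp [annihilation]
    · by_cases h : n = j
      · subst h; simp [annihilation, mul_comm]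
      · simp [annihilation, h]

/-- The canonical commutation relation `a a† = a† a + 1`. -/
theorem annihilation_mul_creation :
    annihilation * creation = creation * annihilation + (1 : Module.End ℂ FiniteFock) := by
  have hs : ∀ r : ℝ, 0 ≤ r → ((√r : ℝ) : ℂ) * ((√r : ℝ) : ℂ) = (r : ℂ) := fun r hr => by
    rw [← Complex.ofReal_mul, Real.mul_self_sqrt hr]
  ext x j
  rcases j with _ | j
  · simp [annihilation_apply, creation_apply]
  · simp only [LinearMap.coe_comp, Function.comp_apply, Module.End.mul_apply, LinearMap.add_apply,
      Finsupp.add_apply, annihilation_apply, creation_apply, Module.End.one_apply]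
    have h1 := hs (((j : ℝ) + 1) + 1) (by positivity)
    have h2 := hs ((j : ℝ) + 1) (by positivity)
    push_cast at h1 h2 ⊢
    rw [← mul_assoc, ← mul_assoc, h1, h2]
    ring

theorem generator_mul_creation (δ : ℂ) :
    generator δ * creation =
      creation * generator δ + (-(starRingEnd ℂ δ)) • (1 : Module.End ℂ FiniteFock) := by
  refine LinearMap.ext fun x => ?_
  have h := LinearMap.congr_fun annihilation_mul_creation x
  simp only [Module.End.mul_apply, LinearMap.add_apply, Module.End.one_apply] at h
  simp only [generator, Module.End.mul_apply, LinearMap.add_apply, LinearMap.sub_apply,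
    LinearMap.smul_apply, Module.End.one_apply, map_sub, map_smul, h]
  module

theorem generator_mul_annihilation (δ : ℂ) :
    generator δ * annihilation =
      annihilation * generator δ + (-δ) • (1 : Module.End ℂ FiniteFock) := by
  refine LinearMap.ext fun x => ?_
  have h := LinearMap.congr_fun annihilation_mul_creation x
  simp only [Module.End.mul_apply, LinearMap.add_apply, Module.End.one_apply] at h
  simp only [generator, Module.End.mul_apply, LinearMap.add_apply, LinearMap.sub_apply,
    LinearMap.smul_apply, Module.End.one_apply, map_sub, map_smul, h]
  module

/-- If `[G, A] = c` is a scalar then `[Gᵏ⁺¹, A] = (k + 1) c Gᵏ`. -/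
theorem pow_succ_mul_of_commutator {G A : Module.End ℂ FiniteFock} {c : ℂ}
    (h : G * A = A * G + c • 1) (k : ℕ) :
    G ^ (k + 1) * A = A * G ^ (k + 1) + ((k + 1 : ℂ) * c) • G ^ k := by
  induction k with
  | zero => simpa using h
  | succ k ih =>
    rw [pow_succ' G (k + 1), mul_assoc, ih, mul_add, ← mul_assoc, h, add_mul, mul_smul_comm,
      ← pow_succ' G k, mul_assoc, smul_mul_assoc, one_mul, add_assoc, ← add_smul]
    push_cast
    congr 2
    ring

/-! ### Matrix elements of the displacement operator -/

theorem toFock_apply (x : FiniteFock) (j : ℕ) : toFock x j = x j := by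
  induction x using Finsupp.induction_linear with
  | zero => simp
  | add x y hx hy => simp [hx, hy]
  | single n c =>
    rw [toFock_single]
    by_cases h : n = j
    · subst h; simp [ket]
    · simp [ket, Ne.symm h]

theorem inner_ket_left (j : ℕ) (ψ : Fock) : ⟪ket j, ψ⟫_ℂ = ψ j := by
  unfold ket
  rw [lp.inner_single_left]
  simp

theorem hasSum_coord {ι : Type*} {f : ι → Fock} {ψ : Fock} (h : HasSum f ψ) (j : ℕ) :
    HasSum (fun i => f i j) (ψ j) := by
  simpa [inner_ket_left] using h.mapL (innerSL ℂ (ket j))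

theorem hasSum_displacedKet_coord (δ : ℂ) (m j : ℕ) :
    HasSum (fun k => (k ! : ℂ)⁻¹ * (generator δ ^ k) (Finsupp.single m 1) j)
      (displacedKet δ m j) := by
  simpa [displacementTerm, toFock_apply] using hasSum_coord (hasSum_displacementTerm δ m) j

/-- If `[G, A] = c` is a scalar, then `exp(G) A = A exp(G) + c exp(G)`, in coordinates and on a
vector where the exponential series converge. -/
theorem hasSum_exp_comp {G A : Module.End ℂ FiniteFock} {c : ℂ} (h : G * A = A * G + c • 1)
    (x : FiniteFock) (j : ℕ) {d S : ℂ}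
    (hd : HasSum (fun k => (k ! : ℂ)⁻¹ * (G ^ k) x j) d)
    (hS : HasSum (fun k => (k ! : ℂ)⁻¹ * A ((G ^ k) x) j) S) :
    HasSum (fun k => (k ! : ℂ)⁻¹ * (G ^ k) (A x) j) (S + c * d) := by
  rw [← hasSum_nat_add_iff' 1] at hS ⊢
  have h1 : ∀ k, (((k + 1)! : ℕ) : ℂ)⁻¹ * (G ^ (k + 1)) (A x) j =
      (((k + 1)! : ℕ) : ℂ)⁻¹ * A ((G ^ (k + 1)) x) j + c * ((k ! : ℂ)⁻¹ * (G ^ k) x j) := by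
    intro k
    have h2 := congrArg (fun T : Module.End ℂ FiniteFock => T x j)
      (pow_succ_mul_of_commutator h k)
    simp only [Module.End.mul_apply, LinearMap.add_apply, LinearMap.smul_apply,
      Finsupp.add_apply, Finsupp.smul_apply, smul_eq_mul] at h2
    rw [h2, Nat.factorial_succ]
    have h3 : (k ! : ℂ) ≠ 0 := by exact_mod_cast Nat.factorial_ne_zero _
    have h4 : (k + 1 : ℂ) ≠ 0 := Nat.cast_add_one_ne_zero k
    push_cast
    field_simp
  simp only [h1]
  refine hasSum_of_eq (hS.add (hd.mul_left c)) (fun _ => rfl) ?_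
  simp
  ring

/-- `√(m+1) ⟨j|D|m+1⟩ = √j ⟨j-1|D|m⟩ - δ* ⟨j|D|m⟩`, from `D a† = (a† - δ*) D`. -/
theorem displacedKet_succ (δ : ℂ) (m j : ℕ) :
    ((√(m + 1 : ℝ) : ℝ) : ℂ) * displacedKet δ (m + 1) j =
      ((√(j : ℝ) : ℝ) : ℂ) * displacedKet δ m (j - 1) - starRingEnd ℂ δ * displacedKet δ m j := by
  have h := hasSum_exp_comp (generator_mul_creation δ) (Finsupp.single m 1) j
    (hasSum_displacedKet_coord δ m j) (S := ((√(j : ℝ) : ℝ) : ℂ) * displacedKet δ m (j - 1)) (by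
      simp only [creation_apply]
      exact hasSum_of_eq ((hasSum_displacedKet_coord δ m (j - 1)).mul_left _)
        (fun k => mul_left_comm _ _ _) rfl)
  have h2 := (hasSum_displacedKet_coord δ (m + 1) j).mul_left ((√(m + 1 : ℝ) : ℝ) : ℂ)
  have h3 : creation (Finsupp.single m 1) =
      ((√(m + 1 : ℝ) : ℝ) : ℂ) • (Finsupp.single (m + 1) 1 : FiniteFock) := by
    rw [creation_single]; simp
  rw [h3] at h
  simp only [map_smul, Finsupp.smul_apply, smul_eq_mul] at h
  have h4 := h2.unique (hasSum_of_eq h (fun k => mul_left_comm _ _ _) rfl)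
  linear_combination h4

/-- `√(j+1) ⟨j+1|D|m⟩ = √m ⟨j|D|m-1⟩ + δ ⟨j|D|m⟩`, from `D a = (a - δ) D`. -/
theorem displacedKet_coord_succ (δ : ℂ) (m j : ℕ) :
    ((√(j + 1 : ℝ) : ℝ) : ℂ) * displacedKet δ m (j + 1) =
      ((√(m : ℝ) : ℝ) : ℂ) * displacedKet δ (m - 1) j + δ * displacedKet δ m j := by
  have h := hasSum_exp_comp (generator_mul_annihilation δ) (Finsupp.single m 1) j
    (hasSum_displacedKet_coord δ m j)
    (S := ((√(j + 1 : ℝ) : ℝ) : ℂ) * displacedKet δ m (j + 1)) (by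
      simp only [annihilation_apply]
      exact hasSum_of_eq ((hasSum_displacedKet_coord δ m (j + 1)).mul_left _)
        (fun k => mul_left_comm _ _ _) rfl)
  have h2 := (hasSum_displacedKet_coord δ (m - 1) j).mul_left ((√(m : ℝ) : ℝ) : ℂ)
  have h3 : annihilation (Finsupp.single m 1) =
      ((√(m : ℝ) : ℝ) : ℂ) • (Finsupp.single (m - 1) 1 : FiniteFock) := by
    rw [annihilation_single]; simp
  rw [h3] at h
  simp only [map_smul, Finsupp.smul_apply, smul_eq_mul] at h
  have h4 := h2.unique (hasSum_of_eq h (fun k => mul_left_comm _ _ _) rfl)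
  linear_combination -h4

/-! ### Coherent vectors -/

theorem memℓp_coherent (w : ℂ) :
    Memℓp (fun n : ℕ => w ^ n / ((√(n ! : ℝ) : ℝ) : ℂ)) 2 := by
  refine memℓp_gen ?_
  have h := Real.summable_pow_div_factorial (‖w‖ ^ 2)
  convert h using 2 with n
  simp only [norm_div, norm_pow, Complex.norm_real, Real.norm_of_nonneg (Real.sqrt_nonneg _)]
  rw [ENNReal.toReal_ofNat, Real.rpow_two, div_pow, Real.sq_sqrt (by positivity), ← pow_mul,
    ← pow_mul, mul_comm]

/-- The unnormalised coherent vector `∑ₙ wⁿ / √n! |n⟩`. -/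
def coherent (w : ℂ) : Fock := ⟨_, memℓp_coherent w⟩

theorem coherent_apply (w : ℂ) (n : ℕ) :
    coherent w n = w ^ n / ((√(n ! : ℝ) : ℝ) : ℂ) := rfl

theorem hasSum_coherent (w : ℂ) :
    HasSum (fun n : ℕ => (w ^ n / ((√(n ! : ℝ) : ℝ) : ℂ)) • ket n) (coherent w) := by
  have h := lp.hasSum_single (E := fun _ : ℕ => ℂ) (p := 2) (by norm_num) (coherent w)
  convert h using 2 with n
  rw [ket, ← lp.single_smul, smul_eq_mul, mul_one, coherent_apply]

theorem sqrt_factorial_succ (n : ℕ) :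
    ((√((n + 1)! : ℝ) : ℝ) : ℂ) = ((√(n + 1 : ℝ) : ℝ) : ℂ) * ((√(n ! : ℝ) : ℝ) : ℂ) := by
  rw [Nat.factorial_succ]
  push_cast
  rw [Real.sqrt_mul (by positivity)]
  push_cast
  rfl

theorem sqrt_factorial_ne_zero (n : ℕ) : ((√(n ! : ℝ) : ℝ) : ℂ) ≠ 0 := by
  have : (0 : ℝ) < (n ! : ℝ) := by exact_mod_cast Nat.factorial_pos n
  exact_mod_cast (Real.sqrt_pos.2 this).ne'

theorem sqrt_succ_ne_zero (n : ℕ) : ((√(n + 1 : ℝ) : ℝ) : ℂ) ≠ 0 := by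
  have : (0 : ℝ) < (n + 1 : ℝ) := by positivity
  exact_mod_cast (Real.sqrt_pos.2 this).ne'

/-- `∑ₘ wᵐ/√m! ⟨j|D|m⟩ = ⟨0|D|0⟩ exp(-δ* w) (w + δ)ʲ/√j!`.  For `j = 0` the recurrence in `m` gives
an exponential series; raising `j` by one multiplies the series by `(w + δ)/√(j+1)`. -/
theorem hasSum_displacedKet_generating (δ w : ℂ) (j : ℕ) :
    HasSum (fun m : ℕ => w ^ m / ((√(m ! : ℝ) : ℝ) : ℂ) * displacedKet δ m j)
      (displacedKet δ 0 0 * Complex.exp (-(starRingEnd ℂ δ * w)) *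
        ((w + δ) ^ j / ((√(j ! : ℝ) : ℝ) : ℂ))) := by
  induction j with
  | zero =>
    have h0 : ∀ m, w ^ m / ((√(m ! : ℝ) : ℝ) : ℂ) * displacedKet δ m 0 =
        displacedKet δ 0 0 * ((-(starRingEnd ℂ δ * w)) ^ m / m !) := by
      intro m
      induction m with
      | zero => simp
      | succ m ih =>
        have h1 := displacedKet_succ δ m 0
        simp only [Nat.cast_zero, Real.sqrt_zero, Complex.ofReal_zero, zero_mul, zero_sub] at h1
        have h2 := sqrt_succ_ne_zero m
        have h3 := sqrt_factorial_ne_zero m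
        have h4 : ((√(m + 1 : ℝ) : ℝ) : ℂ) * ((√(m + 1 : ℝ) : ℝ) : ℂ) = m + 1 := by
          rw [← Complex.ofReal_mul, Real.mul_self_sqrt (by positivity)]; push_cast; rfl
        have h5 : displacedKet δ (m + 1) 0 =
            -(starRingEnd ℂ δ * displacedKet δ m 0) / ((√(m + 1 : ℝ) : ℝ) : ℂ) := by
          rw [← h1]; field_simp
        rw [sqrt_factorial_succ, h5, Nat.factorial_succ]
        have h6 : (-(starRingEnd ℂ δ * w)) ^ (m + 1) / (((m + 1) * m ! : ℕ) : ℂ) =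
            (-(starRingEnd ℂ δ * w)) ^ m / (m ! : ℂ) * (-(starRingEnd ℂ δ * w) / (m + 1)) := by
          push_cast; rw [pow_succ, mul_comm ((m : ℂ) + 1), mul_div_mul_comm]
        rw [h6, ← mul_assoc, ← ih, ← h4]
        field_simp
        ring
    simp only [h0, pow_zero, Nat.factorial_zero, Nat.cast_one, Real.sqrt_one, Complex.ofReal_one,
      div_one, mul_one]
    refine HasSum.mul_left _ ?_
    rw [Complex.exp_eq_exp_ℂ]
    exact NormedSpace.expSeries_div_hasSum_exp _
  | succ j ih =>
    set r : ℂ := ((√(j + 1 : ℝ) : ℝ) : ℂ) with hr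
    have hr0 : r ≠ 0 := sqrt_succ_ne_zero j
    have h1 : HasSum (fun m : ℕ => w ^ m / ((√(m ! : ℝ) : ℝ) : ℂ) *
        (((√(m : ℝ) : ℝ) : ℂ) * displacedKet δ (m - 1) j))
        (w * (displacedKet δ 0 0 * Complex.exp (-(starRingEnd ℂ δ * w)) *
        ((w + δ) ^ j / ((√(j ! : ℝ) : ℝ) : ℂ)))) := by
      rw [← hasSum_nat_add_iff' 1]
      simp only [Finset.range_one, Finset.sum_singleton, Nat.cast_zero, Real.sqrt_zero,
        Complex.ofReal_zero, zero_mul, mul_zero, sub_zero, Nat.add_sub_cancel]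
      refine hasSum_of_eq (ih.mul_left w) (fun m => ?_) rfl
      have h2 := sqrt_succ_ne_zero m
      have h3 := sqrt_factorial_ne_zero m
      rw [sqrt_factorial_succ]
      push_cast
      field_simp
      ring
    have h2 := (h1.add (ih.mul_left δ)).div_const r
    refine hasSum_of_eq h2 (fun m => ?_) ?_
    · have h3 : displacedKet δ m (j + 1) =
          (((√(m : ℝ) : ℝ) : ℂ) * displacedKet δ (m - 1) j + δ * displacedKet δ m j) / r := by
        rw [← displacedKet_coord_succ, ← hr]; field_simp
      rw [h3]
      ring
    · rw [sqrt_factorial_succ, ← hr]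
      have h3 := sqrt_factorial_ne_zero j
      field_simp
      ring

/-- Displacement maps coherent vectors to multiples of coherent vectors. -/
theorem displacement_coherent (δ w : ℂ) :
    displacement δ (coherent w) =
      (displacedKet δ 0 0 * Complex.exp (-(starRingEnd ℂ δ * w))) • coherent (w + δ) := by
  have h : HasSum (fun m : ℕ => (w ^ m / ((√(m ! : ℝ) : ℝ) : ℂ)) • displacedKet δ m)
      (displacement δ (coherent w)) := by
    simpa [displacement_ket] using
      (hasSum_coherent w).mapL (displacement δ).toContinuousLinearMap
  ext j
  have hj := hasSum_coord h j
  simp only [lp.coeFn_smul, Pi.smul_apply, smul_eq_mul] at hj ⊢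
  rw [coherent_apply]
  exact hj.unique (hasSum_displacedKet_generating δ w j)

/-- Otherwise `D` would annihilate every coherent vector, and `D` is injective. -/
theorem displacedKet_zero_zero_ne_zero (δ : ℂ) : displacedKet δ 0 0 ≠ 0 := by
  intro h
  have h1 := displacement_coherent δ 0
  rw [h, zero_mul, zero_smul] at h1
  have h2 : coherent 0 = 0 := (displacement δ).injective (by rw [h1, map_zero])
  have h3 := coherent_apply 0 0
  rw [h2] at h3
  simp at h3

/-! ### Diagonal entries of the no-click element -/

theorem adjoint_displacement_apply (δ : ℂ) (ψ : Fock) :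
    ContinuousLinearMap.adjoint (displacement δ).toContinuousLinearMap (displacement δ ψ) = ψ := by
  refine ext_inner_left ℂ fun ξ => ?_
  rw [ContinuousLinearMap.adjoint_inner_right]
  exact (displacement δ).inner_map_map ξ ψ

theorem noClick_coherent (η : unitInterval) (w : ℂ) :
    noClick η (coherent w) = coherent (((1 - (η : ℝ) : ℝ) : ℂ) * w) := by
  ext n
  rw [noClick_apply, coherent_apply, coherent_apply, mul_pow, Complex.ofReal_pow, mul_div_assoc]

/-- The no-click element maps coherent vectors to multiples of coherent vectors.  The constant
`⟨0|D|0⟩` in the action of the displacement operator cancels between `D` and `D†`. -/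
theorem displacedNoClick_coherent (η : unitInterval) (δ w : ℂ) :
    displacedNoClick η δ (coherent w) =
      (Complex.exp (-((η : ℝ) * (‖δ‖ ^ 2 : ℝ))) * Complex.exp ((η : ℝ) * starRingEnd ℂ δ * w)) •
        coherent (((1 - (η : ℝ) : ℝ) : ℂ) * w + (η : ℝ) * δ) := by
  -- Write `e_w` as an image under `D`, so that the isometry property evaluates `D†`.
  set c := displacedKet δ 0 0 with hc
  have hc0 : c ≠ 0 := displacedKet_zero_zero_ne_zero δ
  set E := Complex.exp (-(starRingEnd ℂ δ * (w - δ))) with hE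
  have hE0 : E ≠ 0 := Complex.exp_ne_zero _
  have h1 : coherent w = displacement δ ((c * E)⁻¹ • coherent (w - δ)) := by
    rw [map_smul, displacement_coherent, smul_smul, sub_add_cancel,
      inv_mul_cancel₀ (mul_ne_zero hc0 hE0), one_smul]
  have h2 : displacedNoClick η δ (coherent w) = displacement δ (noClick η
      (ContinuousLinearMap.adjoint (displacement δ).toContinuousLinearMap (coherent w))) := rfl
  have h3 : ContinuousLinearMap.adjoint (displacement δ).toContinuousLinearMap (coherent w) =
      (c * E)⁻¹ • coherent (w - δ) := by
    rw [h1, adjoint_displacement_apply]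
  rw [h2, h3, map_smul, map_smul, noClick_coherent, displacement_coherent, smul_smul, ← hc]
  have h4 : ((1 - (η : ℝ) : ℝ) : ℂ) * (w - δ) + δ =
      ((1 - (η : ℝ) : ℝ) : ℂ) * w + (η : ℝ) * δ := by
    push_cast; ring
  rw [h4]
  congr 1
  rw [mul_inv, mul_mul_mul_comm, inv_mul_cancel₀ hc0, one_mul, hE, ← Complex.exp_neg,
    ← Complex.exp_add, ← Complex.exp_add]
  congr 1
  have h5 : ((‖δ‖ ^ 2 : ℝ) : ℂ) = starRingEnd ℂ δ * δ := by
    rw [Complex.conj_mul']; push_cast; rfl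
  rw [h5]
  push_cast
  ring

/-- The coefficients of a power series which represents a function on the whole plane are
determined by the function. -/
theorem coeff_unique {a b : ℕ → ℂ} {f : ℂ → ℂ} (ha : ∀ w, HasSum (fun m => w ^ m * a m) (f w))
    (hb : ∀ w, HasSum (fun m => w ^ m * b m) (f w)) : a = b := by
  have key : ∀ a : ℕ → ℂ, (∀ w, HasSum (fun m => w ^ m * a m) (f w)) →
      HasFPowerSeriesAt f (FormalMultilinearSeries.ofScalars ℂ a) 0 := by
    intro a ha
    rw [hasFPowerSeriesAt_iff]
    refine Filter.Eventually.of_forall fun z => ?_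
    simpa [FormalMultilinearSeries.coeff_ofScalars] using ha z
  have h := (key a ha).eq_formalMultilinearSeries (key b hb)
  funext n
  have := congrArg (fun p => FormalMultilinearSeries.coeff p n) h
  simpa [FormalMultilinearSeries.coeff_ofScalars] using this

/-- The power series of `w ↦ exp (α w) (q w + β)ⁿ`. -/
theorem hasSum_exp_mul_affine_pow (α β q w : ℂ) (n : ℕ) :
    HasSum (fun m : ℕ => w ^ m * ∑ j ∈ Finset.range (n + 1),
        if j ≤ m then q ^ j * β ^ (n - j) * (n.choose j : ℂ) * (α ^ (m - j) / (m - j)!) else 0)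
      (Complex.exp (α * w) * (q * w + β) ^ n) := by
  have hexp : HasSum (fun m : ℕ => (α * w) ^ m / m !) (Complex.exp (α * w)) := by
    rw [Complex.exp_eq_exp_ℂ]
    exact NormedSpace.expSeries_div_hasSum_exp _
  have hj : ∀ j, HasSum (fun m : ℕ => w ^ m *
      if j ≤ m then q ^ j * β ^ (n - j) * (n.choose j : ℂ) * (α ^ (m - j) / (m - j)!) else 0)
      (Complex.exp (α * w) * ((q * w) ^ j * β ^ (n - j) * (n.choose j : ℂ))) := by
    intro j
    rw [← hasSum_nat_add_iff' j]
    have h0 : ∑ i ∈ Finset.range j, (w ^ i * if j ≤ i then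
        q ^ j * β ^ (n - j) * (n.choose j : ℂ) * (α ^ (i - j) / (i - j)!) else 0) = 0 := by
      refine Finset.sum_eq_zero fun i hi => ?_
      rw [if_neg (by simpa using hi), mul_zero]
    rw [h0, sub_zero]
    refine hasSum_of_eq (hexp.mul_right ((q * w) ^ j * β ^ (n - j) * (n.choose j : ℂ)))
      (fun m => ?_) rfl
    rw [if_pos (by omega), Nat.add_sub_cancel, pow_add, mul_pow, mul_pow]
    ring
  rw [add_pow, Finset.mul_sum]
  exact hasSum_of_eq (hasSum_sum fun j _ => hj j) (fun m => Finset.mul_sum _ _ _) rfl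

/-- `⟨n|M₀|n⟩ = exp(-η|δ|²) ∑_{j ≤ n} C(n, j) (1-η)ʲ (η²|δ|²)ⁿ⁻ʲ / (n-j)!`. -/
theorem displacedNoClick_diag (η : unitInterval) (δ : ℂ) (n : ℕ) :
    ⟪ket n, displacedNoClick η δ (ket n)⟫_ℂ =
      ((Real.exp (-((η : ℝ) * ‖δ‖ ^ 2)) * ∑ j ∈ Finset.range (n + 1),
        (1 - (η : ℝ)) ^ j * (n.choose j : ℝ) * (((η : ℝ) ^ 2 * ‖δ‖ ^ 2) ^ (n - j) / (n - j)!) :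
          ℝ) : ℂ) := by
  set κ := Complex.exp (-((η : ℝ) * (‖δ‖ ^ 2 : ℝ))) with hκ
  have h1 : ∀ w : ℂ, HasSum
      (fun m : ℕ => w ^ m * (displacedNoClick η δ (ket m) n / ((√(m ! : ℝ) : ℝ) : ℂ)))
      (κ * (((√(n ! : ℝ) : ℝ) : ℂ))⁻¹ * (Complex.exp ((η : ℝ) * starRingEnd ℂ δ * w) *
        (((1 - (η : ℝ) : ℝ) : ℂ) * w + (η : ℝ) * δ) ^ n)) := by
    intro w
    have h := hasSum_coord ((hasSum_coherent w).mapL (displacedNoClick η δ)) n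
    rw [displacedNoClick_coherent] at h
    refine hasSum_of_eq h (fun m => ?_) ?_
    · simp only [map_smul, lp.coeFn_smul, Pi.smul_apply, smul_eq_mul]
      ring
    · simp only [lp.coeFn_smul, Pi.smul_apply, smul_eq_mul, coherent_apply]
      ring
  have h2 := fun w => hasSum_of_eq
    ((hasSum_exp_mul_affine_pow ((η : ℝ) * starRingEnd ℂ δ) ((η : ℝ) * δ)
      ((1 - (η : ℝ) : ℝ) : ℂ) w n).mul_left (κ * (((√(n ! : ℝ) : ℝ) : ℂ))⁻¹))
    (fun m => mul_left_comm _ _ _) rfl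
  have h3 := congrFun (coeff_unique h1 h2) n
  have h4 := sqrt_factorial_ne_zero n
  have h5 : displacedNoClick η δ (ket n) n = κ * ∑ j ∈ Finset.range (n + 1),
      if j ≤ n then ((1 - (η : ℝ) : ℝ) : ℂ) ^ j * ((η : ℝ) * δ) ^ (n - j) * (n.choose j : ℂ) *
        (((η : ℝ) * starRingEnd ℂ δ) ^ (n - j) / (n - j)!) else 0 := by
    rw [div_eq_iff h4] at h3
    rw [h3]
    field_simp
  rw [inner_ket_left, h5]
  push_cast
  rw [hκ]
  push_cast
  congr 1
  refine Finset.sum_congr rfl fun j hj => ?_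
  rw [if_pos (by simpa [Nat.lt_succ_iff] using hj), ← Complex.conj_mul']
  rw [show ((η : ℝ) : ℂ) ^ 2 * (starRingEnd ℂ δ * δ) =
    ((η : ℝ) * δ) * ((η : ℝ) * starRingEnd ℂ δ) by ring, mul_pow ((η : ℝ) * δ)]
  ring

/-! ### The generating function of the diagonal entries -/

theorem hasSum_exp_geometric_row (y : ℝ) {r : ℝ} (hr : |r| < 1) (i : ℕ) :
    HasSum (fun j : ℕ => y ^ i / i ! * (((j + i).choose i : ℝ) * r ^ j))
      (y ^ i / i ! * (1 / (1 - r) ^ (i + 1))) := by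
  have h := hasSum_choose_mul_geometric_of_norm_lt_one i (r := r) (by simpa using hr)
  exact h.mul_left (y ^ i / i !)

theorem hasSum_exp_geometric_outer (y : ℝ) {r : ℝ} :
    HasSum (fun i : ℕ => y ^ i / i ! * (1 / (1 - r) ^ (i + 1)))
      (1 / (1 - r) * Real.exp (y / (1 - r))) := by
  have h : HasSum (fun i : ℕ => (y / (1 - r)) ^ i / i !) (Real.exp (y / (1 - r))) := by
    rw [Real.exp_eq_exp_ℝ]
    exact NormedSpace.expSeries_div_hasSum_exp _
  refine hasSum_of_eq (h.mul_left (1 / (1 - r))) (fun i => ?_) rfl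
  rw [div_pow, pow_succ, one_div, mul_inv, one_div]
  ring

/-- `∑ᵢⱼ yⁱ/i! C(i+j, i) rʲ = exp(y/(1-r))/(1-r)`: the rows `i` are negative binomial series. -/
theorem hasSum_exp_geometric (y : ℝ) {r : ℝ} (hr : |r| < 1) :
    HasSum (fun p : ℕ × ℕ => y ^ p.1 / p.1 ! * (((p.2 + p.1).choose p.1 : ℝ) * r ^ p.2))
      (1 / (1 - r) * Real.exp (y / (1 - r))) := by
  have hr' : |(|r|)| < 1 := by rwa [abs_abs]
  have hs : Summable (fun p : ℕ × ℕ =>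
      y ^ p.1 / p.1 ! * (((p.2 + p.1).choose p.1 : ℝ) * r ^ p.2)) := by
    refine Summable.of_norm ?_
    rw [summable_prod_of_nonneg (fun _ => norm_nonneg _)]
    have hrow : ∀ i : ℕ, HasSum (fun j : ℕ =>
        ‖y ^ i / i ! * (((j + i).choose i : ℝ) * r ^ j)‖)
        (|y| ^ i / i ! * (1 / (1 - |r|) ^ (i + 1))) := fun i =>
      hasSum_of_eq (hasSum_exp_geometric_row |y| hr' i) (fun j => by simp) rfl
    refine ⟨fun i => (hrow i).summable, ?_⟩
    simp only [fun i => (hrow i).tsum_eq]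
    exact (hasSum_exp_geometric_outer |y|).summable
  have h := hs.hasSum.prod_fiberwise (fun i => hasSum_exp_geometric_row y hr i)
  rw [(hasSum_exp_geometric_outer y).unique h]
  exact hs.hasSum

theorem hasSum_sum_antidiagonal {F : ℕ × ℕ → ℝ} {S : ℝ} (hF : HasSum F S) :
    HasSum (fun N => ∑ p ∈ Finset.HasAntidiagonal.antidiagonal N, F p) S := by
  have hG : HasSum (F ∘ Finset.HasAntidiagonal.sigmaAntidiagonalEquivProd) S :=
    Finset.HasAntidiagonal.sigmaAntidiagonalEquivProd.hasSum_iff.2 hF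
  refine hG.sigma fun N => ?_
  have h := hasSum_fintype
    (fun c : {x // x ∈ Finset.HasAntidiagonal.antidiagonal N} => F c.1)
  rw [Finset.sum_coe_sort (Finset.HasAntidiagonal.antidiagonal N) F] at h
  exact h

/-- `∑ₙ xⁿ ∑_{j ≤ n} C(n, j) qʲ tⁿ⁻ʲ / (n-j)! = exp(x t / (1 - q x)) / (1 - q x)`; the left side
is a double series over `j` and `n - j`. -/
theorem hasSum_diag_generating (q t x : ℝ) (hx : |q * x| < 1) :
    HasSum (fun n : ℕ => x ^ n * ∑ j ∈ Finset.range (n + 1),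
        q ^ j * (n.choose j : ℝ) * (t ^ (n - j) / (n - j)!))
      (1 / (1 - q * x) * Real.exp (x * t / (1 - q * x))) := by
  refine hasSum_of_eq (hasSum_sum_antidiagonal (hasSum_exp_geometric (x * t) hx))
    (fun n => ?_) rfl
  rw [← Finset.Nat.sum_antidiagonal_swap,
    Finset.Nat.sum_antidiagonal_eq_sum_range_succ_mk, Finset.mul_sum]
  refine Finset.sum_congr rfl fun j hj => ?_
  have hj' : j ≤ n := by simpa [Nat.lt_succ_iff] using hj
  simp only [Prod.fst_swap, Prod.snd_swap]
  rw [Nat.add_sub_cancel' hj', Nat.choose_symm hj', mul_pow, mul_pow]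
  obtain ⟨k, rfl⟩ := Nat.exists_eq_add_of_le hj'
  rw [Nat.add_sub_cancel_left, pow_add]
  ring

/-- A power series on the unit interval may be differentiated term by term. -/
theorem hasSum_deriv_of_powerSeries {a : ℕ → ℝ} {f : ℝ → ℝ}
    (h : ∀ x, |x| < 1 → HasSum (fun n => x ^ n * a n) (f x)) {x f' : ℝ} (hx : |x| < 1)
    (hf : HasDerivAt f f' x) : HasSum (fun n : ℕ => n * x ^ (n - 1) * a n) f' := by
  -- Convergence at `R` bounds `a n` by `S / Rⁿ`, so the derived series is dominated on `(-r, r)`.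
  obtain ⟨r, hxr, hr1⟩ := exists_between hx
  obtain ⟨R, hrR, hR1⟩ := exists_between hr1
  have hr0 : 0 < r := (abs_nonneg x).trans_lt hxr
  have hR0 : 0 < R := hr0.trans hrR
  have hsR := (h R (by rwa [abs_of_pos hR0])).summable.norm
  set S := ∑' n, ‖R ^ n * a n‖
  have ha : ∀ n, R ^ n * |a n| ≤ S := fun n => by
    have := hsR.le_tsum n (fun _ _ => norm_nonneg _)
    rwa [norm_mul, norm_pow, Real.norm_of_nonneg hR0.le, Real.norm_eq_abs] at this
  have hu : Summable fun n : ℕ => S / r * ((n : ℝ) ^ 1 * (r / R) ^ n) := by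
    have hlt : ‖r / R‖ < 1 := by
      rw [Real.norm_of_nonneg (by positivity), div_lt_one hR0]
      exact hrR
    have hs := summable_pow_mul_geometric_of_norm_lt_one 1 hlt
    exact hs.mul_left (S / r)
  have hbound : ∀ (n : ℕ) (y : ℝ), y ∈ Set.Ioo (-r) r →
      ‖n * y ^ (n - 1) * a n‖ ≤ S / r * ((n : ℝ) ^ 1 * (r / R) ^ n) := by
    intro n y hy
    have hy' : |y| ≤ r := (abs_lt.2 hy).le
    rcases n with _ | n
    · simp
    have h1 : |a (n + 1)| ≤ S / R ^ (n + 1) := by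
      rw [le_div_iff₀ (by positivity), mul_comm]; exact ha _
    rw [norm_mul, norm_mul, norm_pow, Real.norm_natCast, Real.norm_eq_abs, Real.norm_eq_abs,
      Nat.add_sub_cancel]
    calc ((n + 1 : ℕ) : ℝ) * |y| ^ n * |a (n + 1)|
        ≤ ((n + 1 : ℕ) : ℝ) * r ^ n * (S / R ^ (n + 1)) := by gcongr
      _ = _ := by rw [div_pow, pow_succ r]; field_simp
  have hd : ∀ y ∈ Set.Ioo (-r) r, ∀ n : ℕ,
      HasDerivAt (fun z : ℝ => z ^ n * a n) (n * y ^ (n - 1) * a n) y :=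
    fun y _ n => (hasDerivAt_pow n y).mul_const _
  have hxm : x ∈ Set.Ioo (-r) r := abs_lt.1 hxr
  have hsum : Summable fun n : ℕ => n * x ^ (n - 1) * a n :=
    Summable.of_norm_bounded hu fun n => hbound n x hxm
  have hder := hasDerivAt_tsum_of_isPreconnected hu isOpen_Ioo isPreconnected_Ioo
    (fun n y hy => hd y hy n) hbound hxm (h x hx).summable hxm
  have heq : f =ᶠ[nhds x] fun z => ∑' n, z ^ n * a n := by
    filter_upwards [isOpen_Ioo.mem_nhds hxm] with z hz
    exact (h z ((abs_lt.2 hz).trans hr1)).tsum_eq.symm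
  rw [hf.unique (hder.congr_of_eventuallyEq heq)]
  exact hsum.hasSum

theorem hasDerivAt_diag_generating (q t x : ℝ) (hx : 1 - q * x ≠ 0) :
    HasDerivAt (fun x : ℝ => 1 / (1 - q * x) * Real.exp (x * t / (1 - q * x)))
      ((q / (1 - q * x) ^ 2 + t / (1 - q * x) ^ 3) * Real.exp (x * t / (1 - q * x))) x := by
  have h1 : HasDerivAt (fun x : ℝ => 1 - q * x) (-q) x := by
    simpa using ((hasDerivAt_id x).const_mul q).const_sub 1
  have h2 : HasDerivAt (fun x : ℝ => x * t) t x := by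
    simpa using (hasDerivAt_id x).mul_const t
  have h3 := ((hasDerivAt_const x (1 : ℝ)).div h1 hx).mul (h2.div h1 hx).exp
  refine h3.congr_deriv ?_
  simp only [Pi.div_apply]
  field_simp
  ring

/-! ### Partial projections of the heralded vectors -/

theorem inner_ket2 (a b c d : ℕ) :
    ⟪ket2 a b, ket2 c d⟫_ℂ = if a = c ∧ b = d then 1 else 0 := by
  unfold ket2
  rw [lp.inner_single_left, lp.single_apply]
  by_cases h : a = c ∧ b = d
  · obtain ⟨rfl, rfl⟩ := h; simp
  · have h' : ¬ ((a, b) = (c, d)) := by simpa using h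
    simp [h, h']

theorem norm_ket2 (a b : ℕ) : ‖ket2 a b‖ = 1 := by
  unfold ket2
  rw [lp.norm_single (by norm_num)]
  simp

theorem adjoint_tensorKetRight_ket2 (m k l : ℕ) :
    ContinuousLinearMap.adjoint (tensorKetRight m).toContinuousLinearMap (ket2 k l) =
      if l = m then ket k else 0 := by
  ext n
  rw [← inner_ket_left, ContinuousLinearMap.adjoint_inner_right, ← inner_ket_left]
  simp only [LinearIsometry.coe_toContinuousLinearMap, tensorKetRight_ket, inner_ket2]
  by_cases h : l = m
  · subst h; simp [inner_ket]
  · simp [h, Ne.symm h]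

theorem adjoint_tensorKetLeft_ket2 (m k l : ℕ) :
    ContinuousLinearMap.adjoint (tensorKetLeft m).toContinuousLinearMap (ket2 k l) =
      if k = m then ket l else 0 := by
  ext n
  rw [← inner_ket_left, ContinuousLinearMap.adjoint_inner_right, ← inner_ket_left]
  simp only [LinearIsometry.coe_toContinuousLinearMap, tensorKetLeft_ket, inner_ket2]
  by_cases h : k = m
  · subst h; simp [inner_ket]
  · simp [h, Ne.symm h]

/-- The vector `(α √(l+1) [m = l+1] |k⟩ + β √(k+1) [m = l] |k+1⟩) / √2`: what remains of
`signalKet` on one mode when the other mode is projected on `|m⟩`. -/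
def partialKet (α β : ℂ) (k l m : ℕ) : Fock :=
  (((√2)⁻¹ : ℝ) : ℂ) •
    ((α * ((√(l + 1 : ℝ) : ℝ) : ℂ)) • (if l + 1 = m then ket k else 0) +
      (β * ((√(k + 1 : ℝ) : ℝ) : ℂ)) • (if l = m then ket (k + 1) else 0))

theorem adjoint_tensorKetRight_signalKet (u : ℂ) (k l m : ℕ) :
    ContinuousLinearMap.adjoint (tensorKetRight m).toContinuousLinearMap (signalKet u k l) =
      partialKet 1 u k l m := by
  simp only [signalKet, partialKet, map_smul, map_add, adjoint_tensorKetRight_ket2, one_mul]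

theorem adjoint_tensorKetLeft_signalKet (u : ℂ) (k l m : ℕ) :
    ContinuousLinearMap.adjoint (tensorKetLeft m).toContinuousLinearMap (signalKet u l k) =
      partialKet u 1 k l m := by
  simp only [signalKet, partialKet, map_smul, map_add, adjoint_tensorKetLeft_ket2, one_mul]
  rw [add_comm]

/-- The projection `|k⟩⟨k|`. -/
def ketProj (k : ℕ) : Fock →L[ℂ] Fock := InnerProductSpace.rankOne ℂ (ket k) (ket k)

theorem norm_ketProj (k : ℕ) : ‖ketProj k‖ = 1 := by
  simp [ketProj, norm_ket]

theorem ketProj_apply_coord (k n : ℕ) (ψ : Fock) :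
    ketProj k ψ n = if k = n then ψ n else 0 := by
  rw [← inner_ket_left, ketProj, InnerProductSpace.rankOne_apply, inner_smul_right, inner_ket,
    inner_ket_left]
  by_cases h : k = n
  · subst h; simp
  · simp [h, Ne.symm h]

theorem rankOne_smul_self (c : ℂ) (r : ℝ) (hc : ‖c‖ ^ 2 = r) (k : ℕ) :
    InnerProductSpace.rankOne ℂ (c • ket k) (c • ket k) = (r : ℂ) • ketProj k := by
  rw [ketProj, ← hc]
  simp only [map_smul, map_smulₛₗ, smul_apply, smul_smul]
  congr 1
  push_cast
  rw [← Complex.conj_mul']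

/-- The two terms of `partialKet` never occur for the same `m`, so there is no interference. -/
theorem rankOne_partialKet {α β : ℂ} (hα : ‖α‖ = 1) (hβ : ‖β‖ = 1) (k l m : ℕ) :
    InnerProductSpace.rankOne ℂ (partialKet α β k l m) (partialKet α β k l m) =
      (if m = l + 1 then (((l + 1) / 2 : ℝ) : ℂ) • ketProj k else 0) +
        (if m = l then (((k + 1) / 2 : ℝ) : ℂ) • ketProj (k + 1) else 0) := by
  have hn : ∀ (γ : ℂ) (n : ℕ), ‖γ‖ = 1 →
      ‖(((√2)⁻¹ : ℝ) : ℂ) * (γ * ((√(n + 1 : ℝ) : ℝ) : ℂ))‖ ^ 2 = ((n + 1) / 2 : ℝ) := by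
    intro γ n hγ
    rw [norm_mul, norm_mul, hγ, one_mul, Complex.norm_real, Complex.norm_real, Real.norm_eq_abs,
      Real.norm_eq_abs, mul_pow, sq_abs, sq_abs, inv_pow, Real.sq_sqrt (by norm_num),
      Real.sq_sqrt (by positivity)]
    ring
  unfold partialKet
  by_cases h1 : m = l + 1
  · subst h1
    simp only [if_true, Nat.succ_ne_self, (Nat.succ_ne_self l).symm, if_false, smul_zero, add_zero,
      smul_smul]
    exact rankOne_smul_self _ _ (hn α l hα) k
  · by_cases h2 : m = l
    · subst h2
      simp only [if_true, h1, Ne.symm h1, if_false, smul_zero, zero_add, smul_smul]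
      exact rankOne_smul_self _ _ (hn β k hβ) (k + 1)
    · simp [h1, h2, Ne.symm h1, Ne.symm h2]

theorem norm_rankOne_partialKet {α β : ℂ} (hα : ‖α‖ = 1) (hβ : ‖β‖ = 1) (k l m : ℕ) :
    ‖InnerProductSpace.rankOne ℂ (partialKet α β k l m) (partialKet α β k l m)‖ =
      (if m = l + 1 then ((l + 1) / 2 : ℝ) else 0) + (if m = l then ((k + 1) / 2 : ℝ) else 0) := by
  have hn : ∀ n j : ℕ, ‖(((n + 1) / 2 : ℝ) : ℂ) • ketProj j‖ = ((n + 1) / 2 : ℝ) := by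
    intro n j
    rw [norm_smul, norm_ketProj, mul_one, Complex.norm_real, Real.norm_of_nonneg (by positivity)]
  rw [rankOne_partialKet hα hβ]
  by_cases h1 : m = l + 1
  · subst h1
    simp only [if_true, Nat.succ_ne_self, if_false, add_zero, hn]
  · by_cases h2 : m = l
    · subst h2
      simp only [if_true, h1, if_false, zero_add, hn]
    · simp [h1, h2]

/-- `½ (l+1) |k⟩⟨k| + ½ (k+1) |k+1⟩⟨k+1|`, the partial trace of a `signalKet` projection. -/
def reducedSignal (k l : ℕ) : Fock →L[ℂ] Fock :=
  (((l + 1) / 2 : ℝ) : ℂ) • ketProj k + (((k + 1) / 2 : ℝ) : ℂ) • ketProj (k + 1)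

theorem hasSum_rankOne_partialKet {α β : ℂ} (hα : ‖α‖ = 1) (hβ : ‖β‖ = 1) (k l : ℕ) :
    HasSum (fun m => InnerProductSpace.rankOne ℂ (partialKet α β k l m) (partialKet α β k l m))
      (reducedSignal k l) :=
  hasSum_of_eq ((hasSum_ite_eq (l + 1) _).add (hasSum_ite_eq l _))
    (rankOne_partialKet hα hβ k l) rfl

theorem hasSum_norm_rankOne_partialKet {α β : ℂ} (hα : ‖α‖ = 1) (hβ : ‖β‖ = 1) (k l : ℕ) :
    HasSum (fun m =>
      ‖InnerProductSpace.rankOne ℂ (partialKet α β k l m) (partialKet α β k l m)‖)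
      ((l + 1) / 2 + (k + 1) / 2 : ℝ) :=
  hasSum_of_eq ((hasSum_ite_eq (l + 1) _).add (hasSum_ite_eq l _))
    (norm_rankOne_partialKet hα hβ k l) rfl

/-! ### The reduced states as diagonal operators -/

theorem hasSum_succ_mul_geometric {C : ℝ} (h0 : 0 ≤ C) (h1 : C < 1) :
    HasSum (fun l : ℕ => (l + 1 : ℝ) * C ^ l) (1 / (1 - C) ^ 2) := by
  have h := hasSum_choose_mul_geometric_of_norm_lt_one 1 (r := C)
    (by rwa [Real.norm_of_nonneg h0])
  exact hasSum_of_eq h (fun l => by simp) rfl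

theorem hasSum_prod_mul {f g : ℕ → ℝ} {a b : ℝ} (hf : HasSum f a) (hg : HasSum g b)
    (hf0 : ∀ i, 0 ≤ f i) (hg0 : ∀ i, 0 ≤ g i) :
    HasSum (fun p : ℕ × ℕ => f p.1 * g p.2) (a * b) :=
  hf.mul hg (hf.summable.mul_of_nonneg hg.summable hf0 hg0)

theorem summable_pow_add_mul {C : ℝ} (h0 : 0 ≤ C) (h1 : C < 1) :
    Summable fun p : ℕ × ℕ => C ^ (p.1 + p.2) * ((p.2 + 1) / 2 + (p.1 + 1) / 2 : ℝ) := by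
  have hg := hasSum_geometric_of_lt_one h0 h1
  have hs := hasSum_succ_mul_geometric h0 h1
  have ha := hasSum_prod_mul hg hs (fun i => by positivity) (fun i => by positivity)
  have hb := hasSum_prod_mul hs hg (fun i => by positivity) (fun i => by positivity)
  refine (hasSum_of_eq ((ha.add hb).div_const 2) (fun p => ?_) rfl).summable
  rw [pow_add]
  ring

theorem norm_signalKet_sq_le {u : ℂ} (hu : ‖u‖ = 1) (k l : ℕ) :
    ‖signalKet u k l‖ * ‖signalKet u k l‖ ≤ 2 * ((l + 1) / 2 + (k + 1) / 2 : ℝ) := by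
  have h1 : ‖signalKet u k l‖ ≤ (√2)⁻¹ * (√(l + 1 : ℝ) + √(k + 1 : ℝ)) := by
    unfold signalKet
    rw [norm_smul, Complex.norm_real, Real.norm_of_nonneg (by positivity)]
    gcongr
    refine (norm_add_le _ _).trans_eq ?_
    rw [norm_smul, norm_smul, norm_mul, hu, norm_ket2, norm_ket2, Complex.norm_real,
      Complex.norm_real, Real.norm_of_nonneg (Real.sqrt_nonneg _),
      Real.norm_of_nonneg (Real.sqrt_nonneg _)]
    ring
  have h2 : (√(l + 1 : ℝ)) ^ 2 = l + 1 := Real.sq_sqrt (by positivity)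
  have h3 : (√(k + 1 : ℝ)) ^ 2 = k + 1 := Real.sq_sqrt (by positivity)
  have h4 : ((√2 : ℝ)⁻¹) ^ 2 = 1 / 2 := by
    rw [inv_pow, Real.sq_sqrt (by norm_num)]; norm_num
  calc ‖signalKet u k l‖ * ‖signalKet u k l‖
      ≤ ((√2)⁻¹ * (√(l + 1 : ℝ) + √(k + 1 : ℝ))) *
        ((√2)⁻¹ * (√(l + 1 : ℝ) + √(k + 1 : ℝ))) :=
        mul_le_mul h1 h1 (norm_nonneg _) (by positivity)
    _ = ((√2 : ℝ)⁻¹) ^ 2 * (√(l + 1 : ℝ) + √(k + 1 : ℝ)) ^ 2 := by ring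
    _ ≤ 2 * ((l + 1) / 2 + (k + 1) / 2 : ℝ) := by
      rw [h4]
      nlinarith [sq_nonneg (√(l + 1 : ℝ) - √(k + 1 : ℝ))]

theorem hasSum_rhoOut (g rt : ℝ) {u : ℂ} (hu : ‖u‖ = 1) {C : ℝ} (hC : C = rt * Real.tanh g ^ 2)
    (h0 : 0 ≤ C) (h1 : C < 1) :
    HasSum (fun p : ℕ × ℕ => (((1 - C) ^ 3 * C ^ (p.1 + p.2) : ℝ) : ℂ) •
      InnerProductSpace.rankOne ℂ (signalKet u p.1 p.2) (signalKet u p.1 p.2))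
      (rhoOut g rt u) := by
  have hs : Summable fun p : ℕ × ℕ => ((C ^ (p.1 + p.2) : ℝ) : ℂ) •
      InnerProductSpace.rankOne ℂ (signalKet u p.1 p.2) (signalKet u p.1 p.2) := by
    refine Summable.of_norm_bounded ((summable_pow_add_mul h0 h1).mul_left 2) fun p => ?_
    rw [norm_smul, InnerProductSpace.norm_rankOne, Complex.norm_real,
      Real.norm_of_nonneg (by positivity)]
    exact (mul_le_mul_of_nonneg_left (norm_signalKet_sq_le hu _ _) (by positivity)).trans_eq
      (mul_left_comm _ _ _)
  unfold rhoOut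
  rw [← hC]
  refine hasSum_of_eq (hs.hasSum.const_smul (((1 - C) ^ 3 : ℝ) : ℂ)) (fun p => ?_) rfl
  rw [smul_smul, ← Complex.ofReal_mul]

/-- The two iterated sums of a summable double family agree. -/
theorem hasSum_fiberwise_swap {ι κ E : Type*} [NormedAddCommGroup E] {F : ι × κ → E}
    {a : ι → E} {b : κ → E} (hF : Summable F) (ha : ∀ i, HasSum (fun j => F (i, j)) (a i))
    (hb : ∀ j, HasSum (fun i => F (i, j)) (b j)) : HasSum a (∑' j, b j) := by
  have hswap : HasSum (fun q : κ × ι => F (q.2, q.1)) (∑' q, F q) :=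
    (Equiv.prodComm κ ι).hasSum_iff.2 hF.hasSum
  rw [(hswap.prod_fiberwise hb).tsum_eq]
  exact hF.hasSum.prod_fiberwise ha

/-- Partial traces of `rhoOut`, for both modes at once: `R m` tensors with `|m⟩`, and `e` renames
the summation indices. -/
theorem hasSum_reduced (g rt : ℝ) {u : ℂ} (hu : ‖u‖ = 1) {C : ℝ} (hC : C = rt * Real.tanh g ^ 2)
    (h0 : 0 ≤ C) (h1 : C < 1) (R : ℕ → Fock →ₗᵢ[ℂ] Fock2) (e : ℕ × ℕ ≃ ℕ × ℕ)
    (he : ∀ p, (e p).1 + (e p).2 = p.1 + p.2) {α β : ℂ} (hα : ‖α‖ = 1) (hβ : ‖β‖ = 1)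
    (hR : ∀ p m, ContinuousLinearMap.adjoint (R m).toContinuousLinearMap
      (signalKet u (e p).1 (e p).2) = partialKet α β p.1 p.2 m) :
    HasSum (fun p : ℕ × ℕ => (((1 - C) ^ 3 * C ^ (p.1 + p.2) : ℝ) : ℂ) • reducedSignal p.1 p.2)
      (∑' m : ℕ, ContinuousLinearMap.adjoint (R m).toContinuousLinearMap ∘L rhoOut g rt u ∘L
        (R m).toContinuousLinearMap) := by
  have hC3 : 0 ≤ (1 - C) ^ 3 := pow_nonneg (by linarith) 3
  let F : (ℕ × ℕ) × ℕ → (Fock →L[ℂ] Fock) := fun q =>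
    (((1 - C) ^ 3 * C ^ (q.1.1 + q.1.2) : ℝ) : ℂ) •
      InnerProductSpace.rankOne ℂ (partialKet α β q.1.1 q.1.2 q.2)
        (partialKet α β q.1.1 q.1.2 q.2)
  have hnorm : ∀ p : ℕ × ℕ, HasSum (fun m => ‖F (p, m)‖)
      ((1 - C) ^ 3 * (C ^ (p.1 + p.2) * ((p.2 + 1) / 2 + (p.1 + 1) / 2 : ℝ))) := by
    intro p
    refine hasSum_of_eq ((hasSum_norm_rankOne_partialKet hα hβ p.1 p.2).mul_left
      ((1 - C) ^ 3 * C ^ (p.1 + p.2))) (fun m => ?_) (by ring)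
    simp only [F]
    rw [norm_smul, Complex.norm_real, Real.norm_of_nonneg (by positivity)]
  have hF : Summable F := by
    refine Summable.of_norm ?_
    rw [summable_prod_of_nonneg (fun _ => norm_nonneg _)]
    refine ⟨fun p => (hnorm p).summable, ?_⟩
    simp only [fun p => (hnorm p).tsum_eq]
    exact (summable_pow_add_mul h0 h1).mul_left _
  have hrow : ∀ p : ℕ × ℕ, HasSum (fun m => F (p, m))
      ((((1 - C) ^ 3 * C ^ (p.1 + p.2) : ℝ) : ℂ) • reducedSignal p.1 p.2) :=
    fun p => (hasSum_rankOne_partialKet hα hβ p.1 p.2).const_smul _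
  have hρ : HasSum (fun p : ℕ × ℕ => (((1 - C) ^ 3 * C ^ (p.1 + p.2) : ℝ) : ℂ) •
      InnerProductSpace.rankOne ℂ (signalKet u (e p).1 (e p).2) (signalKet u (e p).1 (e p).2))
      (rhoOut g rt u) :=
    hasSum_of_eq (e.hasSum_iff.2 (hasSum_rhoOut g rt hu hC h0 h1))
      (fun p => by simp only [Function.comp_apply, he]) rfl
  have hcol : ∀ m, HasSum (fun p : ℕ × ℕ => F (p, m))
      (ContinuousLinearMap.adjoint (R m).toContinuousLinearMap ∘L rhoOut g rt u ∘L
        (R m).toContinuousLinearMap) := by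
    intro m
    have h := hρ.mapL ((ContinuousLinearMap.compL ℂ Fock Fock2 Fock
        (ContinuousLinearMap.adjoint (R m).toContinuousLinearMap)) ∘L
      ((ContinuousLinearMap.compL ℂ Fock Fock2 Fock2).flip (R m).toContinuousLinearMap))
    refine hasSum_of_eq h (fun p => ?_) rfl
    simp only [F, map_smul, ContinuousLinearMap.comp_apply, ContinuousLinearMap.flip_apply,
      ContinuousLinearMap.compL_apply]
    rw [InnerProductSpace.rankOne_comp, InnerProductSpace.comp_rankOne, hR]
  exact hasSum_fiberwise_swap hF hrow hcol

/-- The photon-number distribution of either reduced state.  At `n = 0` the truncated exponent `n - 1`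
is harmless because of the factor `n`. -/
theorem hasSum_photonNumber {C : ℝ} (h0 : 0 ≤ C) (h1 : C < 1) (n : ℕ) :
    HasSum (fun p : ℕ × ℕ => (1 - C) ^ 3 * C ^ (p.1 + p.2) *
        ((p.2 + 1) / 2 * (if p.1 = n then 1 else 0) +
          (p.1 + 1) / 2 * (if p.1 + 1 = n then 1 else 0)))
      ((1 - C) / 2 * C ^ n + (1 - C) ^ 2 / 2 * (n * C ^ (n - 1))) := by
  have hg := hasSum_geometric_of_lt_one h0 h1
  have hs := hasSum_succ_mul_geometric h0 h1
  have hC : 1 - C ≠ 0 := by linarith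
  have hf1 : HasSum (fun k : ℕ => C ^ k * (if k = n then 1 else 0 : ℝ)) (C ^ n) := by
    refine hasSum_of_eq (hasSum_ite_eq n (C ^ n)) (fun k => ?_) rfl
    by_cases h : k = n <;> simp [h]
  have hf2 : HasSum (fun k : ℕ => (k + 1 : ℝ) * C ^ k * (if k + 1 = n then 1 else 0 : ℝ))
      (n * C ^ (n - 1)) := by
    rcases n with _ | n
    · simp
    · refine hasSum_of_eq (hasSum_ite_eq n ((n + 1 : ℝ) * C ^ n)) (fun k => ?_) (by simp)
      by_cases h : k = n <;> simp [h]
  have ha := hasSum_prod_mul hf1 hs (fun k => by positivity) (fun k => by positivity)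
  have hb := hasSum_prod_mul hf2 hg (fun k => by positivity) (fun k => by positivity)
  refine hasSum_of_eq ((ha.add hb).mul_left ((1 - C) ^ 3 / 2)) (fun p => ?_) ?_
  · rw [pow_add]; ring
  · field_simp

theorem coord_of_hasSum_reducedSignal {C : ℝ} (h0 : 0 ≤ C) (h1 : C < 1) {S : Fock →L[ℂ] Fock}
    (hS : HasSum (fun p : ℕ × ℕ =>
      (((1 - C) ^ 3 * C ^ (p.1 + p.2) : ℝ) : ℂ) • reducedSignal p.1 p.2) S) (ψ : Fock) (n : ℕ) :
    S ψ n = (((1 - C) / 2 * C ^ n + (1 - C) ^ 2 / 2 * (n * C ^ (n - 1)) : ℝ) : ℂ) * ψ n := by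
  have h2 := hasSum_coord (hS.mapL (ContinuousLinearMap.apply ℂ Fock ψ)) n
  have h3 := ((hasSum_photonNumber h0 h1 n).mapL Complex.ofRealCLM).mul_right (ψ n)
  refine h2.unique (hasSum_of_eq h3 (fun p => ?_) rfl)
  simp only [ContinuousLinearMap.apply_apply, reducedSignal, smul_apply,
    add_apply, lp.coeFn_smul, lp.coeFn_add, Pi.smul_apply, Pi.add_apply,
    ketProj_apply_coord, smul_eq_mul, Complex.ofRealCLM_apply]
  push_cast
  split_ifs <;> simp <;> ring

/-! ### The no-click marginal -/

/-- `Tr (S M₀)` for a diagonal operator `S` with the photon-number distribution of the reduced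
heralded state. -/
theorem hasTrace_comp_displacedNoClick {C : ℝ} (h0 : 0 ≤ C) (h1 : C < 1) {S : Fock →L[ℂ] Fock}
    (hS : ∀ ψ n, S ψ n =
      (((1 - C) / 2 * C ^ n + (1 - C) ^ 2 / 2 * (n * C ^ (n - 1)) : ℝ) : ℂ) * ψ n)
    (η : unitInterval) (δ : ℂ) :
    HasTrace (S ∘L displacedNoClick η δ) (((1 - C) / 2 *
      ((2 * (1 - C * (1 - (η : ℝ))) ^ 2 - η * (1 - C * (1 - (η : ℝ))) +
        (1 - C) * (η : ℝ) ^ 2 * ‖δ‖ ^ 2) / (1 - C * (1 - (η : ℝ))) ^ 3) *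
      Real.exp (-(η * (1 - C) * ‖δ‖ ^ 2 / (1 - C * (1 - (η : ℝ))))) : ℝ) : ℂ) := by
  set q : ℝ := 1 - (η : ℝ) with hq
  have hη : (η : ℝ) = 1 - q := by rw [hq]; ring
  have hq0 : 0 ≤ q := by linarith [η.2.2]
  have hq1 : q ≤ 1 := by linarith [η.2.1]
  set t : ℝ := (η : ℝ) ^ 2 * ‖δ‖ ^ 2 with ht
  set μ : ℕ → ℝ := fun n => ∑ j ∈ Finset.range (n + 1),
    q ^ j * (n.choose j : ℝ) * (t ^ (n - j) / (n - j)!) with hμ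
  have habs : |C| < 1 := by rwa [abs_of_nonneg h0]
  have hgen : ∀ x : ℝ, |x| < 1 → HasSum (fun n => x ^ n * μ n)
      (1 / (1 - q * x) * Real.exp (x * t / (1 - q * x))) := by
    intro x hx
    refine hasSum_diag_generating q t x ?_
    rw [abs_mul, abs_of_nonneg hq0]
    exact (mul_le_of_le_one_left (abs_nonneg x) hq1).trans_lt hx
  have hD : 0 < 1 - q * C := by nlinarith
  have hder := hasSum_deriv_of_powerSeries hgen habs (hasDerivAt_diag_generating q t C hD.ne')
  have hsum := (((hgen C habs).mul_left ((1 - C) / 2)).add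
    (hder.mul_left ((1 - C) ^ 2 / 2))).mul_left (Real.exp (-((η : ℝ) * ‖δ‖ ^ 2)))
  refine hasSum_of_eq (hsum.mapL Complex.ofRealCLM) (fun n => ?_) ?_
  · rw [inner_ket_left, ContinuousLinearMap.comp_apply, hS, ← inner_ket_left,
      displacedNoClick_diag, Complex.ofRealCLM_apply, ← Complex.ofReal_mul]
    congr 1
    simp only [hμ, ht, hq]
    ring
  · rw [Complex.ofRealCLM_apply]
    congr 1
    have hexp : Real.exp (-(η * (1 - C) * ‖δ‖ ^ 2 / (1 - C * q))) =
        Real.exp (-((η : ℝ) * ‖δ‖ ^ 2)) * Real.exp (C * t / (1 - q * C)) := by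
      rw [← Real.exp_add]
      congr 1
      rw [mul_comm C q, ht, hη]
      field_simp
      ring
    rw [hexp, mul_comm C q]
    have hkey : (2 * (1 - q * C) ^ 2 - η * (1 - q * C) + (1 - C) * (η : ℝ) ^ 2 * ‖δ‖ ^ 2) /
        (1 - q * C) ^ 3 =
        1 / (1 - q * C) + (1 - C) * (q / (1 - q * C) ^ 2 + t / (1 - q * C) ^ 3) := by
      rw [ht, hη]
      field_simp
      ring
    rw [hkey]
    ring

end Photonic

end

theorem mainTheorem2 (g rt ηd : ℝ) (hrt : rt ∈ Set.Icc (0 : ℝ) 1) (hηd : ηd ∈ Set.Icc (0 : ℝ) 1)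
    (u : ℂ) (hu : ‖u‖ = 1) (δ : ℂ) (C P : ℝ) (hC : C = rt * Real.tanh g ^ 2)
    (hP : P = (1 - C) / 2 *
      ((2 * (1 - C * (1 - ηd)) ^ 2 - ηd * (1 - C * (1 - ηd)) + (1 - C) * ηd ^ 2 * ‖δ‖ ^ 2) /
        (1 - C * (1 - ηd)) ^ 3) *
      Real.exp (-(ηd * (1 - C) * ‖δ‖ ^ 2 / (1 - C * (1 - ηd))))) :
    Photonic.HasTrace
        (Photonic.reducedA (Photonic.rhoOut g rt u) ∘L Photonic.displacedNoClick ⟨ηd, hηd⟩ δ)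
        (P : ℂ) ∧
      Photonic.HasTrace
        (Photonic.reducedB (Photonic.rhoOut g rt u) ∘L Photonic.displacedNoClick ⟨ηd, hηd⟩ δ)
        (P : ℂ) := by
  have h0 : 0 ≤ C := by
    rw [hC]
    exact mul_nonneg hrt.1 (sq_nonneg _)
  have h1 : C < 1 := by
    rw [hC]
    exact (mul_le_of_le_one_left (sq_nonneg _) hrt.2).trans_lt (Real.tanh_sq_lt_one g)
  have h1u : ‖(1 : ℂ)‖ = 1 := norm_one
  subst hP
  constructor
  · refine Photonic.hasTrace_comp_displacedNoClick h0 h1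
      (Photonic.coord_of_hasSum_reducedSignal h0 h1 ?_) ⟨ηd, hηd⟩ δ
    exact Photonic.hasSum_reduced g rt hu hC h0 h1 Photonic.tensorKetRight (Equiv.refl _)
      (fun _ => rfl) h1u hu fun p m => Photonic.adjoint_tensorKetRight_signalKet u p.1 p.2 m
  · refine Photonic.hasTrace_comp_displacedNoClick h0 h1
      (Photonic.coord_of_hasSum_reducedSignal h0 h1 ?_) ⟨ηd, hηd⟩ δ
    exact Photonic.hasSum_reduced g rt hu hC h0 h1 Photonic.tensorKetLeft (Equiv.prodComm _ _)
      (fun p => add_comm _ _) hu h1u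
      fun p m => Photonic.adjoint_tensorKetLeft_signalKet u p.1 p.2 m
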